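/- Let $\mathcal M\subseteq B(H)$ be a von Neumann algebra without central summands of type $I_1$; that is, there is no nonzero central projection $P\in\mathcal M$ for which $P\mathcal M$ is commutative. Let $L:\mathcal M\to\mathcal M$ be an additive map, and let $\xi\in\mathbb C$ be non-rational, i.e. the real and imaginary parts of $\xi$ are not both rational. Write $[A,B]_\xi=AB-\xi BA$, and suppose that $$L([A,B]_\xi)=[L(A),B]_\xi+[A,L(B)]_\xi\qquad\text{for all }A,B\in\mathcal M\text{ with }AB=0.$$ Suppose moreover that at least one of the following conditions holds: (i) the restriction of $L$ to $\mathbb C I=\{zI: z\in\mathbb C\}$ is continuous (for the norm topology); (ii) there exist a number $c>0$ and a sequence of integers $k_n\in\mathbb Z$ with $|k_n|\to\infty$ as $n\to\infty$ such that $\|L(\xi^{k_n}I)\|\le c\,|\xi|^{k_n}$ for all $n$. Then $L$ is an additive derivation, i.e. $L(AB)=L(A)B+AL(B)$ for all $A,B\in\mathcal M$, and $L(\xi I)=0$. -/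

import Mathlib

namespace VonNeumannAlgebra

universe u

variable {H : Type u} [NormedAddCommGroup H] [InnerProductSpace ℂ H] [CompleteSpace H]

/-- A von Neumann algebra is closed under multiplication by complex scalars. -/
instance instSMulMemClassComplex : SMulMemClass (VonNeumannAlgebra H) ℂ (H →L[ℂ] H) where
  smul_mem {S} c {_} hx := S.toStarSubalgebra.smul_mem hx c

/-- `p` is a central projection of `M`: a self-adjoint idempotent lying in the center of `M`. -/
def IsCentralProjection (M : VonNeumannAlgebra H) (p : M) : Prop :=
  IsStarProjection p ∧ p ∈ Set.center M

/-- The corner `p M p` is commutative, that is, `p` is an abelian projection. When `p` is a nonzero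
central projection, this says that the summand `M p` has an abelian unit, i.e. is of type `I₁`. -/
def HasCommutativeCorner (M : VonNeumannAlgebra H) (p : M) : Prop :=
  ∀ A B : M, (p * A * p) * (p * B * p) = (p * B * p) * (p * A * p)

/-- `M` has no (nonzero) central summand of type `I₁`. -/
def NoCentralSummandTypeIOne (M : VonNeumannAlgebra H) : Prop :=
  ∀ p : M, M.IsCentralProjection p → p ≠ 0 → ¬ M.HasCommutativeCorner p

end VonNeumannAlgebra

/-- A complex number is rational if its real and imaginary parts are both rational. -/
def IsRationalComplex (z : ℂ) : Prop :=
  (∃ q : ℚ, z.re = (q : ℝ)) ∧ (∃ q : ℚ, z.im = (q : ℝ))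

/-- The `ξ`-Lie product `[A, B]_ξ = A B - ξ B A`. -/
def xiLie {R : Type*} [Ring R] [Module ℂ R] (ξ : ℂ) (A B : R) : R :=
  A * B - ξ • (B * A)

/-- An additive map (not assumed to be homogeneous) is an additive derivation if it satisfies the
Leibniz rule. -/
def IsAdditiveDerivation {R : Type*} [Ring R] (L : R →+ R) : Prop :=
  ∀ A B : R, L (A * B) = L A * B + A * L B

/-! Put Z = L(I). The core claim, `xiLie_derivable_structure`, is that Z is central and φ(A) = L(A)
- Z A is an additive derivation with φ(ξI) = ξZ. Then φ(ξ^k I) = k ξ^k Z, so L(ξ^k I) = (k + 1) ξ^k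
Z, and the bound in (ii) along |k_n| → ∞ forces Z = 0. Under (i), φ restricted to scalars is a
continuous derivation of ℂ, hence zero, so ξZ = 0. Once Z = 0, L = φ. Non-rationality of ξ enters
only through ξ ≠ 0 and ξ² ≠ 1.

The core claim is ring-theoretic: it needs a semiprime ring with an idempotent P such that P and 1 -
P are both full. If AB = BA = 0, the hypothesis for (A, B) and for (B, A) gives two linear equations
with determinant 1 - ξ², so L(A)B + A L(B) = 0. Tested on idempotents, this makes Z central.
Subtracting Z and adding an inner derivation produces a map δ that kills P and 1 - P; the Leibniz
rule for δ is then checked on Peirce blocks in `IsPeirceXiDerivation`.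

The projection P comes from the absence of type I₁ summands. If all projections under a central
projection z were central, zM would be commutative (`VonNeumannAlgebra.mul_commutator_eq_zero`). So
every nonzero central z dominates a noncentral projection, which gives a full halving of a smaller
central projection; Zorn's lemma glues these local halvings into P. -/

/-! ### Projections and commutativity in a von Neumann algebra -/

open ContinuousLinearMap in
/-- In a von Neumann algebra, the left annihilator of any set is the left annihilator of a
projection. -/
theorem VonNeumannAlgebra.exists_isStarProjection_annihilator {H : Type*} [NormedAddCommGroup H]
    [InnerProductSpace ℂ H] [CompleteSpace H] (M : VonNeumannAlgebra H) (S : Set M) :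
    ∃ e : M, IsStarProjection e ∧ ∀ d : M, (∀ s ∈ S, d * s = 0) ↔ d * e = 0 := by
  let K₀ : Submodule ℂ H := ⨆ s ∈ S, (s : H →L[ℂ] H).range
  let K : Submodule ℂ H := K₀.topologicalClosure
  have : CompleteSpace K := K₀.isClosed_topologicalClosure.completeSpace_coe
  have hproj : IsStarProjection K.starProjection := isStarProjection_starProjection
  -- The closed span of the ranges is invariant under the commutant, so its projection lies in the
  -- bicommutant.
  have hmem : K.starProjection ∈ M := by
    rw [VonNeumannAlgebra.IsStarProjection.mem_iff hproj]
    intro y hy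
    rw [Submodule.range_starProjection, Module.End.mem_invtSubmodule]
    refine K₀.topologicalClosure_minimal ?_
      (K₀.isClosed_topologicalClosure.preimage y.continuous)
    refine iSup₂_le fun s hs => ?_
    rintro _ ⟨h, rfl⟩
    refine K₀.le_topologicalClosure ?_
    have hc : (s : H →L[ℂ] H) * y = y * s := VonNeumannAlgebra.mem_commutant_iff.mp hy s s.2
    have : y ((s : H →L[ℂ] H) h) = (s : H →L[ℂ] H) (y h) := (congrArg (fun T => T h) hc).symm
    change y ((s : H →L[ℂ] H) h) ∈ K₀
    rw [this]
    exact Submodule.mem_iSup_of_mem s (Submodule.mem_iSup_of_mem hs ⟨y h, rfl⟩)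
  refine ⟨⟨_, hmem⟩, ⟨Subtype.ext hproj.isIdempotentElem, Subtype.ext hproj.isSelfAdjoint⟩,
    fun d => ⟨fun hd => ?_, fun hd s hs => ?_⟩⟩
  · have hle : K ≤ (d : H →L[ℂ] H).ker := by
      refine K₀.topologicalClosure_minimal (iSup₂_le fun s hs => ?_)
        (d : H →L[ℂ] H).isClosed_ker
      rintro _ ⟨h, rfl⟩
      exact congrArg (fun T : M => (T : H →L[ℂ] H) h) (hd s hs)
    exact Subtype.ext (ContinuousLinearMap.ext fun h => hle (K.starProjection_apply_mem h))
  · refine Subtype.ext (ContinuousLinearMap.ext fun h => ?_)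
    have hK : (s : H →L[ℂ] H) h ∈ K :=
      K₀.le_topologicalClosure (Submodule.mem_iSup_of_mem s (Submodule.mem_iSup_of_mem hs ⟨h, rfl⟩))
    have h1 := congrArg (fun T : M => (T : H →L[ℂ] H) ((s : H →L[ℂ] H) h)) hd
    change (d : H →L[ℂ] H) (K.starProjection ((s : H →L[ℂ] H) h)) = 0 at h1
    rwa [Submodule.starProjection_eq_self_iff.mpr hK] at h1

/-- Orthogonal direct sum estimate for an operator cut by a projection commuting with it. -/
theorem ContinuousLinearMap.opNorm_le_of_isStarProjection {H : Type*} [NormedAddCommGroup H]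
    [InnerProductSpace ℂ H] [CompleteSpace H] {e x : H →L[ℂ] H} (he : IsStarProjection e)
    (hx : e * x = x * e) {C : ℝ} (hC : 0 ≤ C) (h₁ : ‖x * e‖ ≤ C) (h₂ : ‖x * (1 - e)‖ ≤ C) :
    ‖x‖ ≤ C := by
  have hadj : ∀ u v : H, inner ℂ (e u) v = inner ℂ u (e v) := fun u v => by
    conv_rhs => rw [← he.isSelfAdjoint.star_eq, ContinuousLinearMap.star_eq_adjoint,
      ContinuousLinearMap.adjoint_inner_right]
  have hee : ∀ u, e (e u) = e u := fun u =>
    congrArg (fun T : H →L[ℂ] H => T u) he.isIdempotentElem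
  have hpy : ∀ u : H, ‖u‖ ^ 2 = ‖e u‖ ^ 2 + ‖u - e u‖ ^ 2 := fun u => by
    have h0 : inner ℂ (e u) (u - e u) = 0 := by
      rw [hadj, map_sub, hee, sub_self, inner_zero_right]
    have := norm_add_sq_eq_norm_sq_add_norm_sq_of_inner_eq_zero _ _ h0
    rw [add_sub_cancel] at this
    nlinarith
  refine ContinuousLinearMap.opNorm_le_bound _ hC fun u => ?_
  have hxe : e (x u) = x (e u) := congrArg (fun T : H →L[ℂ] H => T u) hx
  have h3 : ‖x (e u)‖ ≤ C * ‖e u‖ := by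
    have := (x * e).le_of_opNorm_le h₁ (e u)
    simpa [hee] using this
  have h4 : ‖x (u - e u)‖ ≤ C * ‖u - e u‖ := by
    have := (x * (1 - e)).le_of_opNorm_le h₂ (u - e u)
    simpa [hee] using this
  have h5 := hpy (x u)
  rw [hxe, ← map_sub] at h5
  have h6 := hpy u
  refine (sq_le_sq₀ (norm_nonneg _) (by positivity)).mp ?_
  rw [h5, mul_pow, h6, mul_add, ← mul_pow, ← mul_pow]
  gcongr

/-- Continuous functions of a self-adjoint element of a von Neumann algebra stay in it. -/
theorem VonNeumannAlgebra.cfc_real_mem {H : Type*} [NormedAddCommGroup H]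
    [InnerProductSpace ℂ H] [CompleteSpace H] (M : VonNeumannAlgebra H) {a : H →L[ℂ] H}
    (ha : a ∈ M) (f : ℝ → ℝ) : cfc f a ∈ M := by
  rw [← M.commutant_commutant, VonNeumannAlgebra.mem_commutant_iff]
  intro g hg
  have : Commute a g := VonNeumannAlgebra.mem_commutant_iff.mp hg a ha
  exact (this.cfc_real f).symm

/-- If every projection under a central projection `z` is central, then `z M` is commutative:
self-adjoint elements commute with everything. -/
theorem VonNeumannAlgebra.mul_commutator_eq_zero {H : Type*} [NormedAddCommGroup H]
    [InnerProductSpace ℂ H] [CompleteSpace H] (M : VonNeumannAlgebra H) (z : M)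
    (hzz : z * z = z) (hz : ∀ x : M, z * x = x * z)
    (hcent : ∀ e : M, IsStarProjection e → z * e = e → ∀ x : M, e * x = x * e)
    (a : M) (ha : IsSelfAdjoint a) (b : M) : z * (a * b - b * a) = 0 := by
  -- Any bound linear in ‖a‖ improves by a factor 2: a agrees with its positive part on a central
  -- projection and with minus its negative part on the complement, and either part is within ‖a‖ /
  -- 2 of a scalar. Iteration drives the constant to 0.
  have step : ∀ K : ℝ, 0 ≤ K →
      (∀ a : M, IsSelfAdjoint a → ‖z * (a * b - b * a)‖ ≤ K * ‖a‖) →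
      ∀ a : M, IsSelfAdjoint a → ‖z * (a * b - b * a)‖ ≤ K / 2 * ‖a‖ := by
    intro K hK hbound a ha
    have haH : IsSelfAdjoint (a : H →L[ℂ] H) := congrArg Subtype.val ha
    let f : ℝ → ℝ := fun t => max t 0
    let g : ℝ → ℝ := fun t => max (-t) 0
    have hf : Continuous f := by fun_prop
    have hg : Continuous g := by fun_prop
    let p : M := ⟨cfc f (a : H →L[ℂ] H), M.cfc_real_mem a.2 f⟩
    let n : M := ⟨cfc g (a : H →L[ℂ] H), M.cfc_real_mem a.2 g⟩
    have hpn : a = p - n := by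
      apply Subtype.ext
      change (a : H →L[ℂ] H) = cfc f (a : H →L[ℂ] H) - cfc g (a : H →L[ℂ] H)
      rw [← cfc_sub f g (a : H →L[ℂ] H)]
      conv_lhs => rw [← cfc_id ℝ (a : H →L[ℂ] H)]
      refine cfc_congr fun t _ => ?_
      simp only [id, f, g]
      rcases le_total t 0 with h | h <;> simp [h]
    have hnp : n * p = 0 := by
      apply Subtype.ext
      change cfc g (a : H →L[ℂ] H) * cfc f (a : H →L[ℂ] H) = 0
      rw [← cfc_mul g f (a : H →L[ℂ] H)]
      have : (fun t => g t * f t) = fun _ => (0 : ℝ) := by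
        ext t
        simp only [f, g]
        rcases le_total t 0 with h | h <;> simp [h]
      rw [this, cfc_const_zero]
    have hspec : ∀ t ∈ spectrum ℝ (a : H →L[ℂ] H), |t| ≤ ‖a‖ := fun t ht => by
      have h1 := spectrum.norm_le_norm_mul_of_mem ht
      have h2 : ‖(1 : H →L[ℂ] H)‖ ≤ 1 := ContinuousLinearMap.norm_id_le
      calc |t| ≤ ‖(a : H →L[ℂ] H)‖ * ‖(1 : H →L[ℂ] H)‖ := h1
        _ ≤ ‖(a : H →L[ℂ] H)‖ * 1 := by gcongr
        _ = ‖a‖ := by rw [mul_one]; rfl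
    -- centering the positive and negative parts halves their norms
    have center : ∀ k : ℝ → ℝ, Continuous k →
        (∀ t, |t| ≤ ‖a‖ → 0 ≤ k t ∧ k t ≤ ‖a‖) →
        ∀ q : M, (q : H →L[ℂ] H) = cfc k (a : H →L[ℂ] H) →
          ‖z * (q * b - b * q)‖ ≤ K / 2 * ‖a‖ := by
      intro k hk hkb q hq
      let c : M := ((‖a‖ / 2 : ℝ) : ℂ) • (1 : M)
      have hqc : ((q - c : M) : H →L[ℂ] H) = cfc (fun t => k t - ‖a‖ / 2) (a : H →L[ℂ] H) := by
        rw [cfc_sub k (fun _ => ‖a‖ / 2) (a : H →L[ℂ] H), cfc_const _ _ haH, ← hq,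
          Algebra.algebraMap_eq_smul_one]
        rfl
      have hsa : IsSelfAdjoint (q - c) := by
        apply Subtype.ext
        change star ((q - c : M) : H →L[ℂ] H) = ((q - c : M) : H →L[ℂ] H)
        rw [hqc]
        exact IsSelfAdjoint.cfc
      have hnorm : ‖q - c‖ ≤ ‖a‖ / 2 := by
        change ‖((q - c : M) : H →L[ℂ] H)‖ ≤ ‖a‖ / 2
        rw [hqc]
        refine norm_cfc_le (by positivity) fun t ht => ?_
        obtain ⟨h1, h2⟩ := hkb t (hspec t ht)
        rw [Real.norm_eq_abs, abs_le]
        constructor <;> linarith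
      have hcb : c * b = b * c := by
        apply Subtype.ext
        change (((‖a‖ / 2 : ℝ) : ℂ) • (1 : H →L[ℂ] H)) * (b : H →L[ℂ] H) =
          b * (((‖a‖ / 2 : ℝ) : ℂ) • (1 : H →L[ℂ] H))
        rw [smul_mul_assoc, mul_smul_comm, one_mul, mul_one]
      have heq : q * b - b * q = (q - c) * b - b * (q - c) := by
        rw [sub_mul, mul_sub, hcb]; abel
      rw [heq]
      calc _ ≤ K * ‖q - c‖ := hbound _ hsa
        _ ≤ K * (‖a‖ / 2) := by gcongr
        _ = K / 2 * ‖a‖ := by ring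
    have hp := center f hf (fun t ht => ⟨le_max_right _ _,
      max_le ((le_abs_self t).trans ht) (norm_nonneg _)⟩) p rfl
    have hn := center g hg (fun t ht => ⟨le_max_right _ _,
      max_le ((neg_le_abs t).trans ht) (norm_nonneg _)⟩) n rfl
    -- e is the range projection of z p; it lies under z, hence is central by assumption, and it
    -- separates p from n.
    obtain ⟨e, he, hann⟩ := M.exists_isStarProjection_annihilator {z * p}
    simp only [Set.mem_singleton_iff, forall_eq] at hann
    have hze : z * e = e := by
      have := (hann (1 - z)).mp (by rw [← mul_assoc, sub_mul, one_mul, hzz, sub_self, zero_mul])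
      rwa [sub_mul, one_mul, sub_eq_zero, eq_comm] at this
    have hec := hcent e he hze
    have hne : n * e = 0 := (hann n).mp (by rw [← mul_assoc, ← hz, mul_assoc, hnp, mul_zero])
    have hpe : z * p = e * (z * p) := by
      have := (hann (1 - e)).mpr he.one_sub_mul_self
      rwa [sub_mul, one_mul, sub_eq_zero] at this
    have key1 : z * (a * b - b * a) * e = z * (p * b - b * p) * e := by
      have h1 : z * (n * b - b * n) * e = 0 := by
        rw [mul_assoc, sub_mul, mul_assoc n, ← hec b, ← mul_assoc n, hne, mul_assoc b, hne]; simp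
      have h2 : z * (a * b - b * a) = z * (p * b - b * p) - z * (n * b - b * n) := by
        rw [hpn]; noncomm_ring
      rw [h2, sub_mul, h1, sub_zero]
    have key2 : z * (a * b - b * a) * (1 - e) = -(z * (n * b - b * n) * (1 - e)) := by
      have hpe' : z * p * (1 - e) = 0 := by
        rw [mul_sub, mul_one, ← hec, ← hpe, sub_self]
      have hcom : (1 - e) * b = b * (1 - e) := by rw [sub_mul, mul_sub, hec]; simp
      have h1 : z * (p * b - b * p) * (1 - e) = 0 := by
        have h3 : z * p * b * (1 - e) = 0 := by rw [mul_assoc, ← hcom, ← mul_assoc, hpe', zero_mul]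
        have h4 : z * (b * p) * (1 - e) = 0 := by
          rw [← mul_assoc, hz b, mul_assoc b, mul_assoc b, hpe', mul_zero]
        rw [mul_sub z, sub_mul _ _ (1 - e), h4, ← mul_assoc, h3, sub_zero]
      have h2 : z * (a * b - b * a) = z * (p * b - b * p) - z * (n * b - b * n) := by
        rw [hpn]; noncomm_ring
      rw [h2, sub_mul, h1, zero_sub]
    have heH : IsStarProjection (e : H →L[ℂ] H) :=
      ⟨congrArg Subtype.val he.isIdempotentElem, congrArg Subtype.val he.isSelfAdjoint⟩
    have hle : ∀ (x q : M), IsStarProjection (q : H →L[ℂ] H) → ‖x * q‖ ≤ ‖x‖ := fun x q hq => by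
      calc ‖(x : H →L[ℂ] H) * q‖ ≤ ‖(x : H →L[ℂ] H)‖ * ‖(q : H →L[ℂ] H)‖ := norm_mul_le _ _
        _ ≤ ‖(x : H →L[ℂ] H)‖ * 1 := by gcongr; exact hq.norm_le
        _ = ‖x‖ := mul_one _
    refine ContinuousLinearMap.opNorm_le_of_isStarProjection heH
      (congrArg Subtype.val (hec (z * (a * b - b * a)))) (by positivity) ?_ ?_
    · change ‖z * (a * b - b * a) * e‖ ≤ _
      rw [key1]
      exact (hle _ _ heH).trans hp
    · change ‖z * (a * b - b * a) * (1 - e)‖ ≤ _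
      rw [key2, norm_neg]
      exact (hle _ (1 - e) heH.one_sub).trans hn
  have iter : ∀ k : ℕ, ∀ a : M, IsSelfAdjoint a →
      ‖z * (a * b - b * a)‖ ≤ (2 * ‖z‖ * ‖b‖) / 2 ^ k * ‖a‖ := by
    intro k
    induction k with
    | zero =>
      intro a _
      have h1 : ‖a * b - b * a‖ ≤ ‖a‖ * ‖b‖ + ‖b‖ * ‖a‖ :=
        (norm_sub_le _ _).trans (add_le_add (norm_mul_le _ _) (norm_mul_le _ _))
      calc ‖z * (a * b - b * a)‖ ≤ ‖z‖ * ‖a * b - b * a‖ := norm_mul_le _ _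
        _ ≤ ‖z‖ * (‖a‖ * ‖b‖ + ‖b‖ * ‖a‖) := by gcongr
        _ = _ := by ring
    | succ k ih =>
      intro a ha
      have := step _ (by positivity) ih a ha
      rwa [div_div, ← pow_succ] at this
  have hlim : Filter.Tendsto (fun k : ℕ => (2 * ‖z‖ * ‖b‖) / 2 ^ k * ‖a‖) Filter.atTop (nhds 0) := by
    have h1 := (tendsto_pow_atTop_nhds_zero_of_lt_one (r := (1 / 2 : ℝ)) (by norm_num)
      (by norm_num)).const_mul (2 * ‖z‖ * ‖b‖ * ‖a‖)
    rw [mul_zero] at h1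
    refine h1.congr fun k => ?_
    rw [one_div, inv_pow]
    ring
  exact norm_le_zero_iff.mp (ge_of_tendsto' hlim fun k => iter k a ha)

/-! ### Central carriers and a projection that is full together with its complement -/

section FullProjection

variable {R : Type*} [Ring R] [StarRing R]

/-- A projection absorbing left multiplication (`e r e = r e`) is central. -/
theorem IsStarProjection.central_of_left_absorbing {e : R} (he : IsStarProjection e)
    (h : ∀ r, e * r * e = r * e) (r : R) : e * r = r * e := by
  have h1 := congrArg star (h (star r))
  simp only [star_mul, star_star, he.isSelfAdjoint.star_eq] at h1
  rw [← h1, ← mul_assoc, h]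

/-- Central carriers: if left annihilators are generated by projections, the left annihilator of
a set closed under left multiplication is that of a central projection. -/
theorem IsStarProjection.exists_central_carrier
    (hB : ∀ S : Set R, ∃ e, IsStarProjection e ∧ ∀ d, (∀ s ∈ S, d * s = 0) ↔ d * e = 0)
    (S : Set R) (hS : ∀ r, ∀ s ∈ S, r * s ∈ S) :
    ∃ c : R, IsStarProjection c ∧ (∀ r, c * r = r * c) ∧
      ∀ d, (∀ s ∈ S, d * s = 0) ↔ d * c = 0 := by
  obtain ⟨c, hc, hann⟩ := hB S
  refine ⟨c, hc, hc.central_of_left_absorbing fun r => ?_, hann⟩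
  have h1 := (hann (1 - c)).mpr hc.one_sub_mul_self
  have h2 := (hann ((1 - c) * r)).mp fun s hs => by rw [mul_assoc]; exact h1 _ (hS r s hs)
  rw [sub_mul, one_mul, sub_mul, sub_eq_zero] at h2
  exact h2.symm

/-- Below a central projection `z` carrying a noncentral projection `E`, there is a nonzero central
projection `w` in which both `w E` and `w - w E` have full central carrier. -/
theorem IsStarProjection.exists_halving_of_noncentral
    (hB : ∀ S : Set R, ∃ e, IsStarProjection e ∧ ∀ d, (∀ s ∈ S, d * s = 0) ↔ d * e = 0)
    {z E : R} (hz : IsStarProjection z) (hzc : ∀ r, z * r = r * z) (hE : IsStarProjection E)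
    (hzE : z * E = E) (hEc : ¬ ∀ r, E * r = r * E) :
    ∃ w : R, IsStarProjection w ∧ (∀ r, w * r = r * w) ∧ w ≠ 0 ∧ z * w = w ∧
      ∃ G : R, IsStarProjection G ∧ w * G = G ∧
        (∀ d, (∀ r, d * r * G = 0) → d * w = 0) ∧
        (∀ d, (∀ r, d * r * (w - G) = 0) → d * w = 0) := by
  have hEz : E * z = E := by rw [← hzc, hzE]
  have carrier : ∀ F : R, z * F = F → ∃ c : R, IsStarProjection c ∧ (∀ r, c * r = r * c) ∧
      z * c = c ∧ c * F = F ∧ ∀ d, (∀ r, d * r * F = 0) → d * c = 0 := by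
    intro F hF
    obtain ⟨c, hc, hcc, hann⟩ := IsStarProjection.exists_central_carrier hB
      (Set.range fun r => r * F) (by rintro r _ ⟨t, rfl⟩; exact ⟨r * t, mul_assoc _ _ _⟩)
    simp only [Set.forall_mem_range, ← mul_assoc] at hann
    refine ⟨c, hc, hcc, ?_, ?_, fun d hd => (hann d).mp hd⟩
    · have := (hann (1 - z)).mp fun r => by
        rw [sub_mul, one_mul, hzc, sub_mul, mul_assoc r, hF, sub_self]
      rwa [sub_mul, one_mul, sub_eq_zero, eq_comm] at this
    · have := (hann (1 - c)).mpr hc.one_sub_mul_self 1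
      rwa [mul_one, sub_mul, one_mul, sub_eq_zero, eq_comm] at this
  obtain ⟨c, hc, hcc, hzc1, hcE, hcd⟩ := carrier E hzE
  obtain ⟨c', hc', hcc', hzc2, hcF, hcd'⟩ := carrier (z - E) (by
    rw [mul_sub, hz.isIdempotentElem, hzE])
  have hwc : ∀ r, c * c' * r = r * (c * c') := fun r => by
    rw [mul_assoc, hcc', ← mul_assoc, hcc, mul_assoc]
  have hw : IsStarProjection (c * c') := hc.mul hc' (hcc c')
  have hwE : c * c' * E = E * (c * c') := hwc E
  refine ⟨c * c', hw, hwc, fun h0 => hEc ?_, by rw [← mul_assoc, hzc1], c * c' * E,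
    hw.mul hE hwE, by rw [← mul_assoc, hw.isIdempotentElem], fun d hd => ?_, fun d hd => ?_⟩
  -- If the carriers of E and z - E were orthogonal, then E R (z - E) = 0, and taking adjoints would
  -- make E central.
  · have hEF : ∀ r, E * r * (z - E) = 0 := fun r => by
      calc E * r * (z - E) = (c * E) * r * (c' * (z - E)) := by rw [hcE, hcF]
        _ = c * (E * r * c') * (z - E) := by noncomm_ring
        _ = c * (c' * (E * r)) * (z - E) := by rw [hcc']
        _ = (c * c') * (E * r) * (z - E) := by noncomm_ring
        _ = 0 := by rw [h0, zero_mul, zero_mul]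
    have hEr : ∀ r, E * r * E = E * r := fun r => by
      have := hEF r
      rw [mul_sub, sub_eq_zero, mul_assoc, ← hzc, ← mul_assoc, hEz] at this
      exact this.symm
    refine hE.central_of_left_absorbing fun r => ?_
    have h1 := congrArg star (hEr (star r))
    simp only [star_mul, star_star, hE.isSelfAdjoint.star_eq] at h1
    rw [mul_assoc, h1]
  · have h1 := hcd (d * (c * c')) fun r => by
      rw [mul_assoc d, hwc, ← mul_assoc, mul_assoc (d * r), hd]
    have h2 : c * c' * c = c * c' := by rw [mul_assoc, hcc', ← mul_assoc, hc.isIdempotentElem]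
    rwa [mul_assoc, h2] at h1
  · have h1 := hcd' (d * (c * c')) fun r => by
      have h3 : c * c' * (z - E) = c * c' - c * c' * E := by
        rw [mul_sub, ← hzc, ← mul_assoc z, hzc1]
      rw [mul_assoc d, hwc, ← mul_assoc, mul_assoc (d * r), h3, hd]
    have h2 : c * c' * c' = c * c' := by rw [mul_assoc, hc'.isIdempotentElem]
    rwa [mul_assoc, h2] at h1

/-- If every nonzero central projection dominates a noncentral projection, there is a projection
`P` such that `P` and `1 - P` both have central carrier `1`. -/
theorem IsStarProjection.exists_full_halving
    (hB : ∀ S : Set R, ∃ e, IsStarProjection e ∧ ∀ d, (∀ s ∈ S, d * s = 0) ↔ d * e = 0)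
    (hN : ∀ z : R, IsStarProjection z → (∀ r, z * r = r * z) → z ≠ 0 →
      ∃ E, IsStarProjection E ∧ z * E = E ∧ ¬ ∀ r, E * r = r * E) :
    ∃ P : R, IsStarProjection P ∧ (∀ d, (∀ r, d * r * P = 0) → d = 0) ∧
      (∀ d, (∀ r, d * r * (1 - P) = 0) → d = 0) := by
  let good : R × R → Prop := fun x =>
    IsStarProjection x.1 ∧ (∀ r, x.1 * r = r * x.1) ∧ IsStarProjection x.2 ∧ x.1 * x.2 = x.2 ∧
      (∀ d, (∀ r, d * r * x.2 = 0) → d * x.1 = 0) ∧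
      (∀ d, (∀ r, d * r * (x.1 - x.2) = 0) → d * x.1 = 0)
  obtain ⟨T, hT⟩ := zorn_subset
    {T : Set (R × R) | (∀ x ∈ T, good x) ∧ T.Pairwise fun x y => x.1 * y.1 = 0} (by
      intro C hC hchain
      refine ⟨⋃₀ C, ⟨?_, ?_⟩, fun s hs => Set.subset_sUnion_of_mem hs⟩
      · rintro x ⟨s, hs, hx⟩
        exact (hC hs).1 x hx
      · exact (Set.pairwise_sUnion hchain.directedOn).mpr fun s hs => (hC hs).2)
  obtain ⟨⟨hgood, hpair⟩, hmax⟩ := hT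
  -- Otherwise a nonzero central projection is orthogonal to the whole family, and halving part of
  -- it contradicts maximality.
  have faithful : ∀ d : R, (∀ x ∈ T, d * x.1 = 0) → d = 0 := by
    obtain ⟨s, hs, hann⟩ := hB (Prod.fst '' T)
    simp only [Set.forall_mem_image] at hann
    have hsx : ∀ x ∈ T, (1 - s) * x.1 = 0 := fun x hx =>
      (hann (1 - s)).mpr hs.one_sub_mul_self hx
    have hsc : ∀ r, s * r = r * s := hs.central_of_left_absorbing fun r => by
      have h2 := (hann ((1 - s) * r)).mp fun x hx => by
        rw [mul_assoc, ← (hgood x hx).2.1, ← mul_assoc, hsx x hx, zero_mul]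
      rw [sub_mul, one_mul, sub_mul, sub_eq_zero] at h2
      exact h2.symm
    have hone : 1 - s = 0 := by
      by_contra hne
      have hzc : ∀ r, (1 - s) * r = r * (1 - s) := fun r => by
        rw [sub_mul, mul_sub, hsc, one_mul, mul_one]
      obtain ⟨E, hE, hzE, hEc⟩ := hN (1 - s) hs.one_sub hzc hne
      obtain ⟨w, hw, hwc, hw0, hzw, G, hG, hwG, h1, h2⟩ :=
        IsStarProjection.exists_halving_of_noncentral hB hs.one_sub hzc hE hzE hEc
      have hwT : ∀ x ∈ T, w * x.1 = 0 := fun x hx => by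
        rw [← hzw, hzc, mul_assoc, hsx x hx, mul_zero]
      have hmem : (w, G) ∈ T := by
        refine hmax (y := insert (w, G) T) ⟨?_, ?_⟩ (Set.subset_insert _ _) (Set.mem_insert _ _)
        · rintro x (rfl | hx)
          · exact ⟨hw, hwc, hG, hwG, h1, h2⟩
          · exact hgood x hx
        · refine hpair.insert fun x hx _ => ⟨hwT x hx, ?_⟩
          rw [← hwc]
          exact hwT x hx
      exact hw0 (hw.isIdempotentElem ▸ hwT _ hmem)
    intro d hd
    have h1 := (hann d).mp fun x hx => hd x hx
    rwa [← sub_eq_zero.mp hone, mul_one] at h1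
  obtain ⟨P, hP, hann⟩ := hB (Prod.snd '' T)
  simp only [Set.forall_mem_image] at hann
  refine ⟨P, hP, fun d hd => faithful d fun x hx => ?_, fun d hd => faithful d fun x hx => ?_⟩
  · have hPG : P * x.2 = x.2 := by
      have := (hann (1 - P)).mpr hP.one_sub_mul_self hx
      rwa [sub_mul, one_mul, sub_eq_zero, eq_comm] at this
    exact (hgood x hx).2.2.2.2.1 d fun r => by rw [← hPG, ← mul_assoc, hd, zero_mul]
  · obtain ⟨hp, hpc, hG, hpG, h1, h2⟩ := hgood x hx
    -- Orthogonality of the central supports makes the complementary half of x orthogonal to every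
    -- chosen half, hence below 1 - P.
    have hP0 : (x.1 - x.2) * P = 0 := (hann _).mp fun y hy => by
      by_cases hxy : x = y
      · subst hxy
        rw [sub_mul, hpG, hG.isIdempotentElem, sub_self]
      · obtain ⟨-, -, -, hqG, -, -⟩ := hgood y hy
        have h3 : x.1 * y.2 = 0 := by rw [← hqG, ← mul_assoc, hpair hx hy hxy, zero_mul]
        rw [sub_mul, h3, ← hpG, hpc, mul_assoc, h3, mul_zero, sub_zero]
    have hP1 : P * (x.1 - x.2) = 0 := by
      have := congrArg star hP0
      rwa [star_mul, star_sub, hp.isSelfAdjoint.star_eq, hG.isSelfAdjoint.star_eq,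
        hP.isSelfAdjoint.star_eq, star_zero] at this
    have hQ : (1 - P) * (x.1 - x.2) = x.1 - x.2 := by rw [sub_mul, one_mul, hP1, sub_zero]
    exact h2 d fun r => by rw [← hQ, ← mul_assoc, hd, zero_mul]

end FullProjection

/-! ### The Leibniz rule on Peirce blocks -/

/-- Normal form of the problem relative to a pair `P + Q = 1` of full idempotents in a semiprime
ring: `δ` vanishes on `P` and `Q`, satisfies the Leibniz rule on pairs with `A B = B A = 0`, and
satisfies a twisted `ξ`-Lie rule on pairs with `A B = 0`. -/
structure IsPeirceXiDerivation {R : Type*} [Ring R] [Module ℂ R] (ξ : ℂ) (Z : R) (δ : R →+ R)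
    (P Q : R) : Prop where
  ne_zero : ξ ≠ 0
  add_eq : P + Q = 1
  pp : P * P = P
  qq : Q * Q = Q
  pq : P * Q = 0
  qp : Q * P = 0
  full_left : ∀ d : R, (∀ r, d * r * P = 0) → d = 0
  full_right : ∀ d : R, (∀ r, d * r * Q = 0) → d = 0
  semiprime : ∀ d : R, (∀ r, d * r * d = 0) → d = 0
  leibniz : ∀ A B : R, A * B = 0 → B * A = 0 → δ A * B + A * δ B = 0
  xi : ∀ A B : R, A * B = 0 →
    δ (ξ • (B * A)) = ξ • (δ B * A + B * δ A) - δ A * B - A * δ B + ξ • (Z * (B * A))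
  map_left : δ P = 0
  map_right : δ Q = 0

namespace IsPeirceXiDerivation

variable {R : Type*} [Ring R] [Module ℂ R] {ξ : ℂ} {Z : R} {δ : R →+ R} {P Q : R}

theorem symm (h : IsPeirceXiDerivation ξ Z δ P Q) : IsPeirceXiDerivation ξ Z δ Q P where
  ne_zero := h.ne_zero
  add_eq := by rw [add_comm, h.add_eq]
  pp := h.qq
  qq := h.pp
  pq := h.qp
  qp := h.pq
  full_left := h.full_right
  full_right := h.full_left
  semiprime := h.semiprime
  leibniz := h.leibniz
  xi := h.xi
  map_left := h.map_right
  map_right := h.map_left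

theorem mul_left_add (h : IsPeirceXiDerivation ξ Z δ P Q) (A : R) : P * A + Q * A = A := by
  rw [← add_mul, h.add_eq, one_mul]

theorem mul_right_add (h : IsPeirceXiDerivation ξ Z δ P Q) (A : R) : A * P + A * Q = A := by
  rw [← mul_add, h.add_eq, mul_one]

/-- Elements with mismatched inner supports multiply to zero. -/
theorem mul_eq_zero_of (h : IsPeirceXiDerivation ξ Z δ P Q) {A B : R} (hA : A * P = A)
    (hB : Q * B = B) : A * B = 0 := by
  rw [← hA, ← hB, mul_assoc, ← mul_assoc P, h.pq, zero_mul, mul_zero]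

theorem eq_zero_of_two {x : R} (hx : x + x = 0) : x = 0 := by
  have : (2 : ℂ) • x = 0 := by rw [two_smul, hx]
  exact (smul_eq_zero.mp this).resolve_left two_ne_zero

/-- The pair (E, 1 - E) is orthogonal and δ 1 = 0. Varying E extracts information on nonzero
products from a rule about zero products. -/
theorem map_idempotent (h : IsPeirceXiDerivation ξ Z δ P Q) {E : R} (hE : E * E = E) :
    δ E = δ E * E + E * δ E := by
  have h1 : δ 1 = 0 := by rw [← h.add_eq, map_add, h.map_left, h.map_right, add_zero]
  have h2 := h.leibniz E (1 - E) (by rw [mul_sub, hE, mul_one, sub_self])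
    (by rw [sub_mul, hE, one_mul, sub_self])
  rw [map_sub, h1, zero_sub, mul_sub, mul_one, mul_neg, sub_add_eq_add_sub, ← sub_eq_add_neg,
    sub_sub, sub_eq_zero] at h2
  rw [add_comm]
  exact h2

/-- A is orthogonal to Q on both sides, and δ kills Q. -/
theorem map_diag (h : IsPeirceXiDerivation ξ Z δ P Q) {A : R} (hl : P * A = A) (hr : A * P = A) :
    P * δ A = δ A ∧ δ A * P = δ A := by
  have h0 : A * Q = 0 := h.mul_eq_zero_of hr h.qq
  have h1 : Q * A = 0 := h.symm.mul_eq_zero_of h.qq hl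
  have h2 := h.leibniz A Q h0 h1
  have h3 := h.leibniz Q A h1 h0
  rw [h.map_right, mul_zero, add_zero] at h2
  rw [h.map_right, zero_mul, zero_add] at h3
  constructor
  · simpa [h3] using h.mul_left_add (δ A)
  · simpa [h2] using h.mul_right_add (δ A)

/-- `δ X` for `X ∈ P R Q` has vanishing diagonal corners, and its `Q R P` corner `b X` satisfies
`b X * X = 0`. -/
theorem offdiag_corners (h : IsPeirceXiDerivation ξ Z δ P Q) {X : R} (hl : P * X = X)
    (hr : X * Q = X) :
    P * δ X * P = 0 ∧ Q * δ X * Q = 0 ∧ Q * δ X * P * X = 0 := by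
  have hXP : X * P = 0 := h.symm.mul_eq_zero_of hr h.pp
  have hQX : Q * X = 0 := h.symm.mul_eq_zero_of h.qq hl
  have hXX : X * X = 0 := h.symm.mul_eq_zero_of hr hl
  have h1 := h.map_idempotent (E := P + X) (by
    rw [mul_add, add_mul, add_mul, h.pp, hXP, hl, hXX]; abel)
  have h2 := h.map_idempotent (E := P - X) (by
    rw [mul_sub, sub_mul, sub_mul, h.pp, hXP, hl, hXX]; abel)
  rw [map_add, h.map_left, zero_add, mul_add, add_mul] at h1
  rw [map_sub, h.map_left, zero_sub, neg_mul, mul_neg, mul_sub, sub_mul, ← neg_add, neg_inj] at h2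
  have h3 : δ X * X + X * δ X = 0 := by
    apply eq_zero_of_two
    have := sub_eq_zero.mpr (h1.symm.trans h2)
    rw [← this]; abel
  have h4 : δ X = δ X * P + P * δ X := by
    have : δ X = δ X * P + P * δ X + (δ X * X + X * δ X) := by
      conv_lhs => rw [h1]
      abel
    rwa [h3, add_zero] at this
  refine ⟨?_, ?_, ?_⟩
  · have := congrArg (fun t => P * t * P) h4
    simp only [mul_add, add_mul, mul_assoc, h.pp] at this
    rw [← mul_assoc P P, h.pp] at this
    rw [mul_assoc]
    exact left_eq_add.mp this
  · have := congrArg (fun t => Q * t * Q) h4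
    simpa only [mul_add, add_mul, mul_assoc, h.pq, mul_zero, zero_add, ← mul_assoc Q P, h.qp,
      zero_mul] using this
  · have := congrArg (fun t => Q * t) h3
    simp only [mul_add, ← mul_assoc, hQX, zero_mul, add_zero, mul_zero] at this
    rw [mul_assoc _ P, hl, this]

/-- Elements `d = d P` are determined by their action on `P R Q`. -/
theorem eq_zero_of_mul_offdiag (h : IsPeirceXiDerivation ξ Z δ P Q) {d : R} (hd : d * P = d)
    (hX : ∀ X, P * X = X → X * Q = X → d * X = 0) : d = 0 := by
  refine h.full_right d fun r => ?_
  have := hX (P * r * Q) (by simp only [← mul_assoc, h.pp]) (by rw [mul_assoc _ Q, h.qq])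
  rwa [← mul_assoc, ← mul_assoc, hd] at this

/-- Comparison of two evaluations of `δ (ξ A X)`. -/
theorem xi_compare (h : IsPeirceXiDerivation ξ Z δ P Q) {A X : R} (hAl : P * A = A)
    (hAr : A * P = A) (hr : X * Q = X) :
    ξ • (δ A * X + A * δ X) - δ X * A = ξ • (P * δ (A * X)) - δ (A * X) * P := by
  -- The pairs (X, A) and (A X, P) have zero product and the same reversed product A X, so their
  -- twist terms cancel.
  have h1 := h.xi X A (h.symm.mul_eq_zero_of hr hAl)
  have h2 := h.xi (A * X) P (h.symm.mul_eq_zero_of (by rw [mul_assoc, hr]) h.pp)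
  rw [h.symm.mul_eq_zero_of hr (h.map_diag hAl hAr).1, sub_zero] at h1
  rw [h.map_left, zero_mul, mul_zero, zero_add, sub_zero, ← mul_assoc P, hAl, h1] at h2
  exact add_right_cancel h2

section

variable [SMulCommClass ℂ R R]

/-- Only the Q R P corner b X of δ X has to be excluded. Linearising b X * X = 0 and using b (A U) =
b U * A for A in P R P gives b U * r * U = 0 for all r. Linearising once more and invoking
semiprimeness gives b X * r * Y = 0 for every Y in P R Q, and fullness of Q finishes. -/
theorem map_offdiag (h : IsPeirceXiDerivation ξ Z δ P Q) {X : R} (hl : P * X = X)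
    (hr : X * Q = X) : P * δ X = δ X ∧ δ X * Q = δ X := by
  let b : R → R := fun X => Q * δ X * P
  have badd : ∀ U V, b (U + V) = b U + b V := fun U V => by
    simp only [b, map_add, mul_add, add_mul]
  have bP : ∀ U, b U * P = b U := fun U => by simp only [b, mul_assoc, h.pp]
  have anti : ∀ U V, P * U = U → U * Q = U → P * V = V → V * Q = V → b U * V + b V * U = 0 := by
    intro U V hU hU' hV hV'
    have h1 := (h.offdiag_corners (X := U + V) (by rw [mul_add, hU, hV])
      (by rw [add_mul, hU', hV'])).2.2
    change b (U + V) * (U + V) = 0 at h1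
    have h2 : b U * U = 0 := (h.offdiag_corners hU hU').2.2
    have h3 : b V * V = 0 := (h.offdiag_corners hV hV').2.2
    rw [badd, mul_add, add_mul, add_mul, h2, h3, zero_add, add_zero, add_comm] at h1
    exact h1
  have bmul : ∀ A U, P * A = A → A * P = A → P * U = U → U * Q = U → b (A * U) = b U * A := by
    intro A U hAl hAr hU hU'
    have h1 := congrArg (fun t => Q * t) (h.xi_compare hAl hAr hU')
    have hQA : Q * A = 0 := h.symm.mul_eq_zero_of h.qq hAl
    have hQdA : Q * δ A = 0 := h.symm.mul_eq_zero_of h.qq (h.map_diag hAl hAr).1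
    simp only [mul_sub, mul_smul_comm, mul_add, ← mul_assoc, hQA, hQdA, h.qp, zero_mul, add_zero,
      smul_zero, zero_sub, neg_inj] at h1
    simp only [b]
    rw [← h1, mul_assoc _ P, hAl]
  have vanish : ∀ U, P * U = U → U * Q = U → ∀ r, b U * r * U = 0 := by
    intro U hU hU' r
    have hl' : P * (P * r * P) = P * r * P := by simp only [← mul_assoc, h.pp]
    have hr' : P * r * P * P = P * r * P := by rw [mul_assoc _ P, h.pp]
    have h1 : b U * (P * r * P) * U = 0 := by
      apply eq_zero_of_two
      have := anti (P * r * P * U) U (by rw [← mul_assoc, hl']) (by rw [mul_assoc, hU']) hU hU'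
      rwa [bmul _ _ hl' hr' hU hU', ← mul_assoc (b U) _ U] at this
    rw [← h1]
    simp only [mul_assoc, hU]
    rw [← mul_assoc (b U) P, bP]
  have anti' : ∀ U V, P * U = U → U * Q = U → P * V = V → V * Q = V → ∀ r,
      b U * r * V = -(b V * r * U) := by
    intro U V hU hU' hV hV' r
    have h1 := vanish (U + V) (by rw [mul_add, hU, hV]) (by rw [add_mul, hU', hV']) r
    rw [badd, mul_add, add_mul, add_mul, add_mul, vanish U hU hU', vanish V hV hV',
      zero_add, add_zero] at h1
    rw [eq_neg_iff_add_eq_zero, add_comm]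
    exact h1
  have prod : ∀ Y, P * Y = Y → Y * Q = Y → ∀ r, b X * r * Y = 0 := by
    intro Y hY hY' r
    refine h.semiprime _ fun s => ?_
    -- Swapping X and Y in both factors and then back in the first leaves one sign and a word of the
    -- form b X * _ * X.
    have h1 : b X * r * Y * s * (b X * r * Y) = -(b X * (r * Y * s * b Y * r) * X) := by
      rw [anti' X Y hl hr hY hY' r]
      have := anti' X Y hl hr hY hY' r
      calc -(b Y * r * X) * s * -(b Y * r * X)
          = (b X * r * Y) * s * -(b Y * r * X) := by rw [this]
        _ = _ := by noncomm_ring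
    rw [h1, vanish X hl hr, neg_zero]
  have hb : b X = 0 := by
    refine h.full_right _ fun t => ?_
    have := prod (P * t * Q) (by simp only [← mul_assoc, h.pp]) (by rw [mul_assoc _ Q, h.qq]) 1
    rwa [mul_one, ← mul_assoc, ← mul_assoc, bP] at this
  obtain ⟨h1, h2, -⟩ := h.offdiag_corners hl hr
  have hQ : Q * δ X = 0 := by
    rw [← h.mul_right_add (Q * δ X), h2, add_zero]; exact hb
  have hP : δ X * P = 0 := by
    rw [← h.mul_left_add (δ X * P), ← mul_assoc, ← mul_assoc, h1, zero_add]; exact hb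
  constructor
  · simpa [hQ] using h.mul_left_add (δ X)
  · simpa [hP] using h.mul_right_add (δ X)

theorem map_smul_offdiag (h : IsPeirceXiDerivation ξ Z δ P Q) {X : R} (hl : P * X = X)
    (hr : X * Q = X) : δ (ξ • X) = ξ • δ X + ξ • (Z * X) := by
  have h2 := h.xi X P (h.symm.mul_eq_zero_of hr h.pp)
  obtain ⟨h3, h4⟩ := h.map_offdiag hl hr
  rw [h.map_left, zero_mul, mul_zero, zero_add, sub_zero, hl, h3,
    h.symm.mul_eq_zero_of h4 h.pp, sub_zero] at h2
  exact h2

theorem map_mul_diag_offdiag (h : IsPeirceXiDerivation ξ Z δ P Q) {A X : R} (hAl : P * A = A)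
    (hAr : A * P = A) (hl : P * X = X) (hr : X * Q = X) :
    δ (A * X) = δ A * X + A * δ X := by
  have h1 := h.xi_compare hAl hAr hr
  obtain ⟨h3, h4⟩ := h.map_offdiag (X := A * X) (by rw [← mul_assoc, hAl]) (by rw [mul_assoc, hr])
  rw [h.symm.mul_eq_zero_of (h.map_offdiag hl hr).2 hAl, h3, h.symm.mul_eq_zero_of h4 h.pp,
    sub_zero, sub_zero] at h1
  exact ((smul_right_injective R h.ne_zero) h1).symm

theorem map_mul_offdiag_diag (h : IsPeirceXiDerivation ξ Z δ P Q) {X B : R} (hl : P * X = X)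
    (hr : X * Q = X) (hBl : Q * B = B) (hBr : B * Q = B) :
    δ (X * B) = δ X * B + X * δ B := by
  have h1 := h.xi B X (h.symm.mul_eq_zero_of hBr hl)
  obtain ⟨-, h5⟩ := h.symm.map_diag hBl hBr
  rw [h.symm.mul_eq_zero_of h5 hl, h.symm.mul_eq_zero_of hBr (h.map_offdiag hl hr).1, sub_zero,
    sub_zero, h.map_smul_offdiag (by rw [← mul_assoc, hl]) (by rw [mul_assoc, hBr])] at h1
  exact (smul_right_injective R h.ne_zero) (add_right_cancel h1)

/-- Expanding δ (A B X) with both bracketings shows that the Leibniz defect of (A, B) annihilates P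
R Q, so it is zero. -/
theorem map_mul_diag_diag (h : IsPeirceXiDerivation ξ Z δ P Q) {A B : R} (hAl : P * A = A)
    (hAr : A * P = A) (hBl : P * B = B) (hBr : B * P = B) :
    δ (A * B) = δ A * B + A * δ B := by
  have hABl : P * (A * B) = A * B := by rw [← mul_assoc, hAl]
  have hABr : A * B * P = A * B := by rw [mul_assoc, hBr]
  rw [← sub_eq_zero]
  refine h.eq_zero_of_mul_offdiag ?_ fun X hl hr => ?_
  · rw [sub_mul, add_mul, (h.map_diag hABl hABr).2, mul_assoc, hBr, mul_assoc,
      (h.map_diag hBl hBr).2]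
  · have h1 := h.map_mul_diag_offdiag hABl hABr hl hr
    have h2 := h.map_mul_diag_offdiag hAl hAr (X := B * X) (by rw [← mul_assoc, hBl])
      (by rw [mul_assoc, hr])
    rw [h.map_mul_diag_offdiag hBl hBr hl hr, ← mul_assoc A B X, h1] at h2
    have h3 : δ (A * B) * X = δ A * (B * X) + A * (δ B * X + B * δ X) - A * B * δ X :=
      eq_sub_of_add_eq h2
    rw [sub_mul, h3]
    noncomm_ring

/-- Conjugating the idempotent P + Y by 1 + X gives an idempotent whose P R P corner involves X Y.
The P R P corner of `map_idempotent` there says that the defect d = δ (X Y) - δ X * Y - X * δ Y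
satisfies d + X Y d = 0. -/
theorem map_mul_offdiag_offdiag (h : IsPeirceXiDerivation ξ Z δ P Q) {X Y : R} (hXl : P * X = X)
    (hXr : X * Q = X) (hYl : Q * Y = Y) (hYr : Y * P = Y) :
    δ (X * Y) = δ X * Y + X * δ Y := by
  have key : ∀ X, P * X = X → X * Q = X →
      (δ (X * Y) - δ X * Y - X * δ Y) + X * Y * (δ (X * Y) - δ X * Y - X * δ Y) = 0 := by
    intro X hl hr
    have hXX : X * X = 0 := h.symm.mul_eq_zero_of hr hl
    have hXP : X * P = 0 := h.symm.mul_eq_zero_of hr h.pp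
    have hPY : P * Y = 0 := h.mul_eq_zero_of h.pp hYl
    have hYY : Y * Y = 0 := h.mul_eq_zero_of hYr hYl
    have hF : (P + Y) * (P + Y) = P + Y := by
      rw [mul_add, add_mul, add_mul, h.pp, hPY, hYr, hYY]; abel
    have hinv : (1 - X) * (1 + X) = 1 := by
      rw [mul_add, sub_mul, sub_mul, hXX, mul_one, one_mul]; simp
    have hE : ((1 + X) * (P + Y) * (1 - X)) * ((1 + X) * (P + Y) * (1 - X)) =
        (1 + X) * (P + Y) * (1 - X) := by
      calc _ = (1 + X) * ((P + Y) * ((1 - X) * (1 + X)) * (P + Y)) * (1 - X) := by noncomm_ring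
        _ = _ := by rw [hinv, mul_one, hF]
    have hEeq : (1 + X) * (P + Y) * (1 - X) = P + X * Y - X - X * Y * X + Y - Y * X := by
      have : (1 + X) * (P + Y) * (1 - X) =
          P + Y + X * P + X * Y - P * X - Y * X - X * P * X - X * Y * X := by noncomm_ring
      rw [this, hXP, hl]
      simp only [zero_mul]
      abel
    rw [hEeq] at hE
    have hA1 : P * (X * Y) = X * Y := by rw [← mul_assoc, hl]
    have hA2 : X * Y * P = X * Y := by rw [mul_assoc, hYr]
    have hB1 : Q * (Y * X) = Y * X := by rw [← mul_assoc, hYl]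
    have hB2 : Y * X * Q = Y * X := by rw [mul_assoc, hr]
    have hU1 : P * (X * Y * X) = X * Y * X := by rw [← mul_assoc, hA1]
    have hU2 : X * Y * X * Q = X * Y * X := by rw [mul_assoc, hr]
    obtain ⟨dA1, dA2⟩ := h.map_diag hA1 hA2
    obtain ⟨dB1, dB2⟩ := h.symm.map_diag hB1 hB2
    obtain ⟨dX1, dX2⟩ := h.map_offdiag hl hr
    obtain ⟨dY1, dY2⟩ := h.symm.map_offdiag hYl hYr
    obtain ⟨dU1, dU2⟩ := h.map_offdiag hU1 hU2
    have h1 := congrArg (fun t => P * t * P) (h.map_idempotent hE)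
    have hdE : δ (P + X * Y - X - X * Y * X + Y - Y * X) =
        δ (X * Y) - δ X - δ (X * Y * X) + δ Y - δ (Y * X) := by
      simp only [map_add, map_sub, h.map_left, zero_add]
    rw [hdE] at h1
    generalize hD : δ (X * Y) - δ X - δ (X * Y * X) + δ Y - δ (Y * X) = D at h1
    have hPD : P * D = δ (X * Y) - δ X - δ (X * Y * X) := by
      rw [← hD, mul_sub, mul_add, mul_sub, mul_sub, dA1, dX1, dU1, h.mul_eq_zero_of h.pp dY1,
        h.mul_eq_zero_of h.pp dB1, add_zero, sub_zero]
    have hDP : D * P = δ (X * Y) + δ Y := by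
      rw [← hD, sub_mul, add_mul, sub_mul, sub_mul, dA2, dY2, h.symm.mul_eq_zero_of dX2 h.pp,
        h.symm.mul_eq_zero_of dU2 h.pp, h.symm.mul_eq_zero_of dB2 h.pp, sub_zero, sub_zero,
        sub_zero]
    have hEP : (P + X * Y - X - X * Y * X + Y - Y * X) * P = P + X * Y + Y := by
      rw [sub_mul, add_mul, sub_mul, sub_mul, add_mul, h.pp, hA2, hXP,
        h.symm.mul_eq_zero_of hU2 h.pp, h.symm.mul_eq_zero_of hB2 h.pp, hYr, sub_zero, sub_zero,
        sub_zero]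
    have hPE : P * (P + X * Y - X - X * Y * X + Y - Y * X) = P + X * Y - X - X * Y * X := by
      rw [mul_sub, mul_add, mul_sub, mul_sub, mul_add, h.pp, hA1, hl, hU1, hPY,
        h.mul_eq_zero_of h.pp hB1, add_zero, sub_zero]
    have h2 : δ (X * Y) = (δ (X * Y) - δ X - δ (X * Y * X)) * (P + X * Y + Y) +
        (P + X * Y - X - X * Y * X) * (δ (X * Y) + δ Y) := by
      have h3 : P * D * P = δ (X * Y) := by
        rw [hPD, sub_mul, sub_mul, dA2, h.symm.mul_eq_zero_of dX2 h.pp,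
          h.symm.mul_eq_zero_of dU2 h.pp, sub_zero, sub_zero]
      have h4 : P * D * P = (P * D) * ((P + X * Y - X - X * Y * X + Y - Y * X) * P) +
          (P * (P + X * Y - X - X * Y * X + Y - Y * X)) * (D * P) := by
        refine h1.trans ?_
        noncomm_ring
      rw [hEP, hPE, hDP, hPD] at h4
      rw [← h4, ← hPD, h3]
    have e1 : (δ (X * Y) - δ X - δ (X * Y * X)) * (P + X * Y + Y) =
        δ (X * Y) + δ (X * Y) * (X * Y) - δ X * Y - δ (X * Y * X) * Y := by
      rw [mul_add, mul_add, sub_mul, sub_mul, sub_mul, sub_mul, sub_mul, sub_mul, dA2,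
        h.symm.mul_eq_zero_of dX2 h.pp, h.symm.mul_eq_zero_of dU2 h.pp,
        h.symm.mul_eq_zero_of dX2 hA1, h.symm.mul_eq_zero_of dU2 hA1,
        h.mul_eq_zero_of dA2 hYl]
      abel
    have e2 : (P + X * Y - X - X * Y * X) * (δ (X * Y) + δ Y) =
        δ (X * Y) + X * Y * δ (X * Y) - X * δ Y - X * Y * X * δ Y := by
      rw [mul_add, sub_mul, sub_mul, add_mul, sub_mul, sub_mul, add_mul, dA1,
        h.symm.mul_eq_zero_of hr dA1, h.symm.mul_eq_zero_of hU2 dA1,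
        h.mul_eq_zero_of h.pp dY1, h.mul_eq_zero_of hA2 dY1]
      abel
    rw [e1, e2, h.map_mul_diag_offdiag hA1 hA2 hl hr] at h2
    rw [← sub_eq_zero.mpr h2.symm]
    noncomm_ring
  have h1 := key X hXl hXr
  -- Under X ↦ -X the term d is odd and X Y d is even, so subtracting the two identities leaves 2 d
  -- = 0.
  have h2 := key (-X) (by rw [mul_neg, hXl]) (by rw [neg_mul, hXr])
  simp only [neg_mul, map_neg] at h2
  have h3 : δ (X * Y) - δ X * Y - X * δ Y = 0 := by
    apply eq_zero_of_two
    have := congrArg₂ (· - ·) h1 h2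
    simp only [sub_zero] at this
    rw [← this]
    noncomm_ring
  rw [sub_sub, sub_eq_zero] at h3
  exact h3

theorem map_mul_of_left (h : IsPeirceXiDerivation ξ Z δ P Q) {A : R} (hA : P * A = A) (B : R) :
    δ (A * B) = δ A * B + A * δ B := by
  have hB : B = P * B * P + P * B * Q + (Q * B * P + Q * B * Q) := by
    rw [h.mul_right_add, h.mul_right_add, h.mul_left_add]
  have l : ∀ r S, P * (P * r * S) = P * r * S := fun r S => by simp only [← mul_assoc, h.pp]
  have l' : ∀ r S, Q * (Q * r * S) = Q * r * S := fun r S => by simp only [← mul_assoc, h.qq]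
  have r : ∀ S, S * P * P = S * P := fun S => by rw [mul_assoc, h.pp]
  have r' : ∀ S, S * Q * Q = S * Q := fun S => by rw [mul_assoc, h.qq]
  have zero : ∀ {U V : R}, U * P = U → δ U * P = δ U → Q * V = V → Q * δ V = δ V →
      δ (U * V) = δ U * V + U * δ V := fun h1 h2 h3 h4 => by
    rw [h.mul_eq_zero_of h1 h3, h.mul_eq_zero_of h2 h3, h.mul_eq_zero_of h1 h4, map_zero, add_zero]
  have zero' : ∀ {U V : R}, U * Q = U → δ U * Q = δ U → P * V = V → P * δ V = δ V →
      δ (U * V) = δ U * V + U * δ V := fun h1 h2 h3 h4 => by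
    rw [h.symm.mul_eq_zero_of h1 h3, h.symm.mul_eq_zero_of h2 h3, h.symm.mul_eq_zero_of h1 h4,
      map_zero, add_zero]
  have hAP : P * (A * P) = A * P := by rw [← mul_assoc, hA]
  have hAQ : P * (A * Q) = A * Q := by rw [← mul_assoc, hA]
  have dAP := (h.map_diag hAP (r A)).2
  have dAQ := (h.map_offdiag hAQ (r' A)).2
  have dPP := (h.map_diag (l B P) (r _)).1
  have dPQ := (h.map_offdiag (l B Q) (r' _)).1
  have dQP := (h.symm.map_offdiag (l' B P) (r _)).1
  have dQQ := (h.symm.map_diag (l' B Q) (r' _)).1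
  have a1 := h.map_mul_diag_diag hAP (r A) (l B P) (r _)
  have a2 := h.map_mul_diag_offdiag hAP (r A) (l B Q) (r' _)
  have a3 := zero (r A) dAP (l' B P) dQP
  have a4 := zero (r A) dAP (l' B Q) dQQ
  have b1 := zero' (r' A) dAQ (l B P) dPP
  have b2 := zero' (r' A) dAQ (l B Q) dPQ
  have b3 := h.map_mul_offdiag_offdiag hAQ (r' A) (l' B P) (r _)
  have b4 := h.map_mul_offdiag_diag hAQ (r' A) (l' B Q) (r' _)
  rw [hB, ← h.mul_right_add A]
  generalize P * B * P = B₁ at *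
  generalize P * B * Q = B₂ at *
  generalize Q * B * P = B₃ at *
  generalize Q * B * Q = B₄ at *
  generalize A * P = A₁ at *
  generalize A * Q = A₂ at *
  simp only [add_mul, mul_add, map_add, a1, a2, a3, a4, b1, b2, b3, b4]
  abel

theorem map_mul (h : IsPeirceXiDerivation ξ Z δ P Q) (A B : R) :
    δ (A * B) = δ A * B + A * δ B := by
  have h1 := h.map_mul_of_left (A := P * A) (by rw [← mul_assoc, h.pp]) B
  have h2 := h.symm.map_mul_of_left (A := Q * A) (by rw [← mul_assoc, h.qq]) B
  have h3 := congrArg₂ (· + ·) h1 h2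
  simp only [← map_add, ← add_mul] at h3
  rw [h.add_eq, one_mul] at h3
  conv_rhs => rw [← h.mul_left_add A]
  rw [h3, map_add]
  noncomm_ring

variable [IsScalarTower ℂ R R]

/-- For X in P R Q, δ (ξ X) is known from the twisted rule and from the Leibniz rule; comparing them
shows that δ (ξ 1) - ξ Z kills P R Q, and by symmetry Q R P. -/
theorem map_smul_one (h : IsPeirceXiDerivation ξ Z δ P Q) : δ (ξ • 1) = ξ • Z := by
  have half : ∀ {P Q : R}, IsPeirceXiDerivation ξ Z δ P Q → (δ (ξ • 1) - ξ • Z) * P = 0 := by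
    intro P Q h
    refine h.eq_zero_of_mul_offdiag (by rw [mul_assoc, h.pp]) fun X hl hr => ?_
    have h1 := h.map_smul_offdiag hl hr
    have h2 := h.map_mul (ξ • 1) X
    rw [smul_mul_assoc, one_mul, h1, smul_mul_assoc, one_mul, add_comm] at h2
    rw [mul_assoc, hl, sub_mul, smul_mul_assoc, ← add_right_cancel h2, sub_self]
  rw [← sub_eq_zero, ← h.mul_right_add (δ (ξ • 1) - ξ • Z), half h, half h.symm, add_zero]

end

end IsPeirceXiDerivation

/-! ### Reduction of the ξ-Lie condition to the Peirce normal form -/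

/-- Structure of additive maps that are `ξ`-Lie derivable at zero products (`ξ ≠ 0, ±1`): if `P` is
an idempotent with `P` and `1 - P` full in a semiprime ring, then `L A = φ A + L 1 * A` with `L 1`
central, `φ` an additive derivation and `φ (ξ • 1) = ξ • L 1`. -/
theorem xiLie_derivable_structure {R : Type*} [Ring R] [Module ℂ R] [IsScalarTower ℂ R R]
    [SMulCommClass ℂ R R] {ξ : ℂ} (hξ0 : ξ ≠ 0) (hξ1 : ξ ^ 2 ≠ 1) (L : R →+ R)
    (hL : ∀ A B : R, A * B = 0 → L (xiLie ξ A B) = xiLie ξ (L A) B + xiLie ξ A (L B))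
    (P : R) (hPP : P * P = P) (hP : ∀ d : R, (∀ r, d * r * P = 0) → d = 0)
    (hQ : ∀ d : R, (∀ r, d * r * (1 - P) = 0) → d = 0)
    (hsemi : ∀ d : R, (∀ r, d * r * d = 0) → d = 0) :
    (∀ A, L 1 * A = A * L 1) ∧ IsAdditiveDerivation (L - AddMonoidHom.mulLeft (L 1)) ∧
      L (ξ • 1) - L 1 * (ξ • 1) = ξ • L 1 := by
  have hxi : ∀ A B : R, A * B = 0 →
      L (ξ • (B * A)) = ξ • (L B * A + B * L A) - L A * B - A * L B := by
    intro A B hAB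
    have h := hL A B hAB
    simp only [xiLie, hAB, zero_sub, map_neg] at h
    rw [neg_eq_iff_eq_neg] at h
    rw [h, smul_add]
    abel
  have hann : ∀ A B : R, A * B = 0 → B * A = 0 → L A * B + A * L B = 0 := by
    intro A B hAB hBA
    have h1 := hxi A B hAB
    have h2 := hxi B A hBA
    rw [hBA, smul_zero, map_zero, sub_sub, eq_comm, sub_eq_zero] at h1
    rw [hAB, smul_zero, map_zero, sub_sub, eq_comm, sub_eq_zero] at h2
    have h3 : (ξ ^ 2 - 1) • (L A * B + A * L B) = 0 := by
      rw [sub_smul, one_smul, pow_two, mul_smul, h2, h1, sub_self]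
    exact (smul_eq_zero.mp h3).resolve_left (sub_ne_zero.mpr hξ1)
  have hidem : ∀ E : R, E * E = E → L 1 * E = E * L 1 := by
    intro E hE
    have h0 : E * (1 - E) = 0 := by rw [mul_sub, hE, mul_one, sub_self]
    have h0' : (1 - E) * E = 0 := by rw [sub_mul, hE, one_mul, sub_self]
    have h1 := hann E (1 - E) h0 h0'
    have h2 := hann (1 - E) E h0' h0
    have h3 := sub_eq_zero.mpr (h2.trans h1.symm)
    rw [← sub_eq_zero, ← h3, map_sub]
    noncomm_ring
  have hZ : ∀ A, L 1 * A = A * L 1 := by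
    have hQQ : (1 - P) * (1 - P) = 1 - P := by
      rw [sub_mul, one_mul, mul_sub, mul_one, hPP, sub_self, sub_zero]
    have hPQ : P * (1 - P) = 0 := by rw [mul_sub, hPP, mul_one, sub_self]
    have hQP : (1 - P) * P = 0 := by rw [sub_mul, hPP, one_mul, sub_self]
    have off : ∀ p q : R, p * p = p → q * q = q → q * p = 0 → p * q = 0 → ∀ r,
        L 1 * (p * r * q) = p * r * q * L 1 := by
      intro p q hp hq hqp hpq r
      -- Both p and p + p r q are idempotents, so L 1 commutes with their difference.
      have h1 : (p + p * r * q) * (p + p * r * q) = p + p * r * q := by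
        calc _ = p * p + (p * p) * r * q + p * r * (q * p) + p * r * (q * p) * r * q := by
              noncomm_ring
          _ = _ := by rw [hp, hqp]; simp
      have h2 := hidem _ h1
      rw [mul_add, add_mul, hidem p hp] at h2
      exact add_left_cancel h2
    have diag : ∀ p q : R, p * p = p → q * q = q → q * p = 0 → p * q = 0 →
        (∀ d : R, (∀ r, d * r * q = 0) → d = 0) → ∀ r,
        L 1 * (p * r * p) = p * r * p * L 1 := by
      intro p q hp hq hqp hpq hfull r
      rw [← sub_eq_zero]
      -- Multiplying by s q on the right turns the commutator into an expression in off-diagonal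
      -- elements, already handled.
      refine hfull _ fun s => ?_
      have h1 : (L 1 * (p * r * p) - p * r * p * L 1) * s * q =
          (L 1 * (p * r * p) - p * r * (L 1 * p)) * s * q := by
        rw [mul_assoc (p * r) p, hidem p hp]
      have h2 : (L 1 * (p * r * p) - p * r * (L 1 * p)) * s * q =
          L 1 * (p * (r * p * s) * q) - p * r * (L 1 * (p * s * q)) := by noncomm_ring
      rw [h1, h2, off p q hp hq hqp hpq, off p q hp hq hqp hpq]
      noncomm_ring
    intro A
    have hA : A = P * A * P + P * A * (1 - P) + (1 - P) * A * P + (1 - P) * A * (1 - P) := by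
      noncomm_ring
    rw [hA]
    simp only [mul_add (L 1), add_mul _ _ (L 1)]
    rw [diag P (1 - P) hPP hQQ hQP hPQ hQ, diag (1 - P) P hQQ hPP hPQ hQP hP,
      off P (1 - P) hPP hQQ hQP hPQ, off (1 - P) P hQQ hPP hPQ hQP]
  generalize hL1 : L 1 = Z at hZ ⊢
  have hZr : ∀ A B : R, A * (Z * B) = Z * (A * B) := fun A B => by
    rw [← mul_assoc, ← hZ, mul_assoc]
  -- With D = L P - Z P one has D = D P + P D, hence P D P = 0 and T P - P T = -D. So adding this
  -- inner derivation makes δ P vanish.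
  let T : R := P * (L P - Z * P) - (L P - Z * P) * P
  let δ : R →+ R := L - AddMonoidHom.mulLeft Z +
    (AddMonoidHom.mulLeft T - AddMonoidHom.mulRight T)
  have hδ : ∀ A, δ A = L A - Z * A + (T * A - A * T) := fun A => rfl
  have hT : ∀ A B : R, A * B = 0 → (T * A - A * T) * B + A * (T * B - B * T) = 0 := by
    intro A B hAB
    have : (T * A - A * T) * B + A * (T * B - B * T) = T * (A * B) - A * B * T := by noncomm_ring
    rw [this, hAB, mul_zero, zero_mul, sub_zero]
  have leib : ∀ A B : R, A * B = 0 → B * A = 0 → δ A * B + A * δ B = 0 := by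
    intro A B hAB hBA
    have h1 : δ A * B + A * δ B = (L A * B + A * L B) - Z * (A * B) - A * (Z * B) +
        ((T * A - A * T) * B + A * (T * B - B * T)) := by
      rw [hδ, hδ]; noncomm_ring
    rw [h1, hann A B hAB hBA, hT A B hAB, hZr, hAB]
    simp
  -- Subtracting Z costs one copy of ξ Z B A on the left side and two on the right, whence the extra
  -- term.
  have hδxi : ∀ A B : R, A * B = 0 →
      δ (ξ • (B * A)) = ξ • (δ B * A + B * δ A) - δ A * B - A * δ B + ξ • (Z * (B * A)) := by
    intro A B hAB
    have h1 : δ A * B + A * δ B = L A * B + A * L B := by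
      have : δ A * B + A * δ B = (L A * B + A * L B) - Z * (A * B) - A * (Z * B) +
          ((T * A - A * T) * B + A * (T * B - B * T)) := by
        rw [hδ, hδ]; noncomm_ring
      rw [this, hT A B hAB, hZr, hAB]
      simp
    have h2 : δ B * A + B * δ A = L B * A + B * L A - Z * (B * A) - Z * (B * A) +
        (T * (B * A) - B * A * T) := by
      rw [hδ, hδ]
      have := hZr B A
      calc _ = L B * A + B * L A - Z * (B * A) - B * (Z * A) + (T * (B * A) - B * A * T) := by
            noncomm_ring
        _ = _ := by rw [this]
    rw [sub_sub _ _ (A * δ B), h1, h2, hδ, hxi A B hAB]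
    simp only [mul_smul_comm, smul_mul_assoc, smul_add, smul_sub]
    abel
  have hδ1 : δ 1 = 0 := by rw [hδ, hL1]; simp
  have hδP : δ P = 0 := by
    have h1 := hann P (1 - P) (by rw [mul_sub, hPP, mul_one, sub_self])
      (by rw [sub_mul, hPP, one_mul, sub_self])
    rw [map_sub, hL1] at h1
    have hZP : P * (Z * P) = Z * P := by rw [hZr, hPP]
    have hD : L P - Z * P = (L P - Z * P) * P + P * (L P - Z * P) := by
      have h2 : (L P - Z * P) - ((L P - Z * P) * P + P * (L P - Z * P)) =
          L P * (1 - P) + P * (Z - L P) + (Z * (P * P) + P * (Z * P) - Z * P - P * Z) := by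
        noncomm_ring
      rw [h1, hZP, hPP, ← hZ P, zero_add] at h2
      rw [← sub_eq_zero, h2]
      abel
    have hPDP : P * (L P - Z * P) * P = 0 := by
      have h3 := congrArg (fun t => P * t * P) hD
      simp only [mul_add, add_mul, mul_assoc, hPP] at h3
      rw [← mul_assoc P P, hPP] at h3
      rw [mul_assoc]
      exact left_eq_add.mp h3
    rw [hδ]
    simp only [T]
    generalize L P - Z * P = D at hD hPDP
    have h4 : (P * D - D * P) * P - P * (P * D - D * P) =
        P * D * P + P * D * P - (D * (P * P) + (P * P) * D) := by noncomm_ring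
    rw [h4, hPDP, hPP, ← hD]
    abel
  have hpeirce : IsPeirceXiDerivation ξ Z δ P (1 - P) :=
    { ne_zero := hξ0
      add_eq := add_sub_cancel _ _
      pp := hPP
      qq := by rw [sub_mul, one_mul, mul_sub, mul_one, hPP, sub_self, sub_zero]
      pq := by rw [mul_sub, hPP, mul_one, sub_self]
      qp := by rw [sub_mul, hPP, one_mul, sub_self]
      full_left := hP
      full_right := hQ
      semiprime := hsemi
      leibniz := leib
      xi := hδxi
      map_left := hδP
      map_right := by rw [map_sub, hδ1, hδP, sub_zero] }
  refine ⟨hZ, fun A B => ?_, ?_⟩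
  · have h1 := hpeirce.map_mul A B
    rw [hδ, hδ, hδ] at h1
    change L (A * B) - Z * (A * B) = (L A - Z * A) * B + A * (L B - Z * B)
    rw [← eq_sub_iff_add_eq] at h1
    rw [h1]
    noncomm_ring
  · have h1 := hpeirce.map_smul_one
    rw [hδ, mul_smul_comm, mul_smul_comm, smul_mul_assoc, mul_one, mul_one, one_mul, sub_self,
      add_zero] at h1
    rw [← h1, mul_smul_comm, mul_one]

/-! ### Derivations on scalars and the conclusion for von Neumann algebras -/

/-- A derivation-like map `φ` on scalars with `φ ξ = ξ Z` satisfies `φ (ξ ^ k) = k ξ ^ k Z`. -/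
theorem derivation_zpow_smul_one {R : Type*} [Ring R] [Module ℂ R] [IsScalarTower ℂ R R]
    [SMulCommClass ℂ R R] {φ : R →+ R} (hφ : IsAdditiveDerivation φ) {ξ : ℂ} (hξ : ξ ≠ 0) {Z : R}
    (h : φ (ξ • 1) = ξ • Z) (k : ℤ) : φ (ξ ^ k • 1) = (k : ℂ) • ξ ^ k • Z := by
  have hmul : ∀ z : ℂ, φ ((z * ξ) • 1) = ξ • φ (z • 1) + (z * ξ) • Z := fun z => by
    have h1 := hφ (z • 1) (ξ • 1)
    rw [h, smul_mul_smul_comm, one_mul, smul_mul_assoc, mul_smul_comm, one_mul, mul_one,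
      smul_smul] at h1
    exact h1
  have h1 : φ 1 = 0 := by
    have := hφ 1 1
    simpa using this
  induction k with
  | zero => simpa using h1
  | succ n ih =>
    rw [zpow_add_one₀ hξ, hmul, ih]
    push_cast
    module
  | pred n ih =>
    have h2 := hmul (ξ ^ (-(n : ℤ) - 1))
    have h3 : ξ ^ (-(n : ℤ) - 1) * ξ = ξ ^ (-(n : ℤ)) := by
      rw [← zpow_add_one₀ hξ, sub_add_cancel]
    rw [h3, ih, ← h3] at h2
    apply smul_right_injective R hξ
    change ξ • _ = ξ • _
    rw [← sub_eq_iff_eq_add.mpr h2]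
    push_cast
    module

/-- Taking r = d* gives (d d*)(d d*) = 0, and the C*-identity applied twice gives d = 0. -/
theorem VonNeumannAlgebra.eq_zero_of_forall_mul_mul_self {H : Type*} [NormedAddCommGroup H]
    [InnerProductSpace ℂ H] [CompleteSpace H] (M : VonNeumannAlgebra H) (d : M)
    (hd : ∀ r : M, d * r * d = 0) : d = 0 := by
  have h1 : star ((d : H →L[ℂ] H) * star (d : H →L[ℂ] H)) *
      ((d : H →L[ℂ] H) * star (d : H →L[ℂ] H)) = 0 := by
    have := congrArg (fun t : M => (t : H →L[ℂ] H) * star (d : H →L[ℂ] H)) (hd (star d))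
    simp only [ZeroMemClass.coe_zero, zero_mul] at this
    rw [star_mul, star_star, ← mul_assoc]
    exact this
  exact Subtype.ext ((CStarRing.mul_star_self_eq_zero_iff _).mp
    ((CStarRing.star_mul_self_eq_zero_iff _).mp h1))

/-- In a von Neumann algebra without type `I₁` central summands every nonzero central projection
dominates a noncentral projection. -/
theorem VonNeumannAlgebra.NoCentralSummandTypeIOne.exists_noncentral {H : Type*}
    [NormedAddCommGroup H] [InnerProductSpace ℂ H] [CompleteSpace H] {M : VonNeumannAlgebra H}
    (hM : M.NoCentralSummandTypeIOne) (z : M) (hz : IsStarProjection z)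
    (hzc : ∀ r, z * r = r * z) (hz0 : z ≠ 0) :
    ∃ E : M, IsStarProjection E ∧ z * E = E ∧ ¬ ∀ r, E * r = r * E := by
  by_contra! hcon
  refine hM z ⟨hz, Semigroup.mem_center_iff.mpr fun r => (hzc r).symm⟩ hz0 ?_
  have hsa := M.mul_commutator_eq_zero z hz.isIdempotentElem hzc fun e he hze => hcon e he hze
  have hall : ∀ A B : M, z * (A * B - B * A) = 0 := by
    intro A B
    have h1 := hsa (A + star A) (IsSelfAdjoint.add_star_self A) B
    have h2 := hsa (Complex.I • (A - star A)) (by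
      apply Subtype.ext
      change star (Complex.I • ((A : H →L[ℂ] H) - star (A : H →L[ℂ] H))) =
        Complex.I • ((A : H →L[ℂ] H) - star (A : H →L[ℂ] H))
      rw [star_smul, star_sub, star_star, Complex.star_def, Complex.conj_I, neg_smul, ← smul_neg,
        neg_sub]) B
    rw [smul_mul_assoc, mul_smul_comm, ← smul_sub, mul_smul_comm] at h2
    have h3 := (smul_eq_zero.mp h2).resolve_left Complex.I_ne_zero
    have h4 : (2 : ℂ) • (z * (A * B - B * A)) = 0 := by
      rw [two_smul]
      calc _ = z * ((A + star A) * B - B * (A + star A)) +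
            z * ((A - star A) * B - B * (A - star A)) := by noncomm_ring
        _ = 0 := by rw [h1, h3, add_zero]
    exact (smul_eq_zero.mp h4).resolve_left two_ne_zero
  intro A B
  have h : ∀ C : M, z * C * z = C * z := fun C => by rw [hzc, mul_assoc, hz.isIdempotentElem]
  rw [h, h, ← sub_eq_zero]
  calc A * z * (B * z) - B * z * (A * z) = A * (z * B * z) - B * (z * A * z) := by noncomm_ring
    _ = z * (A * B - B * A) := by rw [h, h, hzc]; noncomm_ring
    _ = 0 := hall A B

/-- A continuous derivation of the scalars into a module vanishes. -/
theorem continuous_scalar_derivation_eq_zero {E : Type*} [NormedAddCommGroup E] [NormedSpace ℂ E]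
    (u : ℂ →+ E) (hu : Continuous u) (hmul : ∀ z w, u (z * w) = z • u w + w • u z) (z : ℂ) :
    u z = 0 := by
  have h1 : u 1 = 0 := by simpa using hmul 1 1
  have hreal : ∀ (r : ℝ) (w : ℂ), u (r * w) = r • u w := fun r w => by
    rw [← map_real_smul u hu, Complex.real_smul]
  have hI : u Complex.I = 0 := by
    have h2 := hmul Complex.I Complex.I
    rw [Complex.I_mul_I, map_neg, h1, neg_zero, ← two_smul ℂ, smul_smul, eq_comm, smul_eq_zero] at h2
    exact h2.resolve_left (mul_ne_zero two_ne_zero Complex.I_ne_zero)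
  rw [← Complex.re_add_im z, map_add, hreal, hI, smul_zero, add_zero, ← mul_one (z.re : ℂ), hreal,
    h1, smul_zero]

theorem corollary3p3 {H : Type*} [NormedAddCommGroup H] [InnerProductSpace ℂ H] [CompleteSpace H]
    (M : VonNeumannAlgebra H) (hM : M.NoCentralSummandTypeIOne)
    (L : M →+ M) (ξ : ℂ) (hξ : ¬ IsRationalComplex ξ)
    (hL : ∀ A B : M, A * B = 0 → L (xiLie ξ A B) = xiLie ξ (L A) B + xiLie ξ A (L B))
    (hcond :
      ContinuousOn L (Set.range fun z : ℂ => z • (1 : M)) ∨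
      ∃ c : ℝ, 0 < c ∧ ∃ k : ℕ → ℤ,
        Filter.Tendsto (fun n => |k n|) Filter.atTop Filter.atTop ∧
        ∀ n : ℕ, ‖L (ξ ^ k n • (1 : M))‖ ≤ c * ‖ξ‖ ^ k n) :
    IsAdditiveDerivation L ∧ L (ξ • (1 : M)) = 0 := by
  have hξ0 : ξ ≠ 0 := by
    rintro rfl
    exact hξ ⟨⟨0, by simp⟩, ⟨0, by simp⟩⟩
  have hξ1 : ξ ^ 2 ≠ 1 := by
    intro h
    rcases sq_eq_sq_iff_eq_or_eq_neg.mp (h.trans (one_pow 2).symm) with rfl | rfl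
    · exact hξ ⟨⟨1, by simp⟩, ⟨0, by simp⟩⟩
    · exact hξ ⟨⟨-1, by simp⟩, ⟨0, by simp⟩⟩
  obtain ⟨P, hP, hfull, hfull'⟩ := IsStarProjection.exists_full_halving
    M.exists_isStarProjection_annihilator hM.exists_noncentral
  obtain ⟨hZ, hder, hone⟩ := xiLie_derivable_structure hξ0 hξ1 L hL P hP.isIdempotentElem hfull
    hfull' M.eq_zero_of_forall_mul_mul_self
  have hval : ∀ z : ℂ, (L - AddMonoidHom.mulLeft (L 1)) (z • 1) = L (z • 1) - z • L 1 :=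
    fun z => by
      rw [AddMonoidHom.sub_apply, AddMonoidHom.coe_mulLeft, mul_smul_comm, mul_one]
  have hξZ : (L - AddMonoidHom.mulLeft (L 1)) (ξ • 1) = ξ • L 1 := hone
  have hZ0 : L 1 = 0 := by
    rcases hcond with hc | ⟨c, -, k, hk, hbound⟩
    · let u : ℂ →+ (H →L[ℂ] H) :=
        { toFun := fun z => ((L - AddMonoidHom.mulLeft (L 1)) (z • 1) : M)
          map_zero' := by simp
          map_add' := fun z w => by rw [add_smul, map_add]; rfl }
      have hcont : Continuous fun z : ℂ => L (z • (1 : M)) :=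
        hc.comp_continuous (Continuous.subtype_mk (by fun_prop) _) fun z => ⟨z, rfl⟩
      have hu : Continuous u := by
        have : (u : ℂ → H →L[ℂ] H) = fun z => (L (z • (1 : M)) : H →L[ℂ] H) -
            z • ((L 1 : M) : H →L[ℂ] H) := by
          ext1 z
          exact congrArg Subtype.val (hval z)
        rw [this]
        exact (continuous_subtype_val.comp hcont).sub (continuous_id.smul continuous_const)
      have h1 := continuous_scalar_derivation_eq_zero u hu (fun z w => by
        have h2 := hder (z • 1) (w • 1)
        rw [smul_mul_smul_comm, one_mul, smul_mul_assoc, one_mul, mul_smul_comm, mul_one,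
          add_comm] at h2
        exact congrArg Subtype.val h2) ξ
      have h2 : ξ • L 1 = 0 := by rw [← hξZ]; exact Subtype.ext h1
      exact (smul_eq_zero.mp h2).resolve_left hξ0
    -- The shift from k to k + 1 comes from adding back ξ^k L 1 to φ (ξ^k) = k ξ^k L 1; the factor
    -- |ξ|^k then cancels from the bound.
    · have hle : ∀ n, |((k n + 1 : ℤ) : ℝ)| * ‖L 1‖ ≤ c := by
        intro n
        have h1 := derivation_zpow_smul_one hder hξ0 hξZ (k n)
        rw [hval, sub_eq_iff_eq_add] at h1
        have h2 : L (ξ ^ k n • 1) = ((k n + 1 : ℂ) * ξ ^ k n) • L 1 := by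
          rw [h1]; module
        have h3 := hbound n
        have h4 : ‖L (ξ ^ k n • 1)‖ = |((k n + 1 : ℤ) : ℝ)| * ‖ξ‖ ^ k n * ‖L 1‖ := by
          rw [h2]
          change ‖((k n + 1 : ℂ) * ξ ^ k n) • ((L 1 : M) : H →L[ℂ] H)‖ = _
          rw [norm_smul, norm_mul, norm_zpow]
          have : (k n + 1 : ℂ) = (((k n + 1 : ℤ) : ℝ) : ℂ) := by push_cast; rfl
          rw [this, Complex.norm_real, Real.norm_eq_abs]
          rfl
        rw [h4] at h3
        have hpos : 0 < ‖ξ‖ ^ k n := zpow_pos (norm_pos_iff.mpr hξ0) _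
        refine le_of_mul_le_mul_right ?_ hpos
        linarith
      by_contra hne
      have hpos : 0 < ‖L 1‖ := norm_pos_iff.mpr hne
      obtain ⟨N, hN⟩ := exists_int_gt (c / ‖L 1‖ + 1)
      obtain ⟨n, hn⟩ := (hk.eventually_ge_atTop N).exists
      have h1 := (le_div_iff₀ hpos).mpr (hle n)
      have h2 : ((|k n| : ℤ) : ℝ) ≤ |((k n + 1 : ℤ) : ℝ)| + 1 := by
        push_cast
        have := abs_sub ((k n : ℝ) + 1) 1
        rw [add_sub_cancel_right, abs_one] at this
        exact this
      have h3 : (N : ℝ) ≤ ((|k n| : ℤ) : ℝ) := by exact_mod_cast hn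
      linarith
  rw [hZ0] at hder hone
  constructor
  · intro A B
    simpa using hder A B
  · simpa using hone
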